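/- Let $\mathsf X$ be a non-compact Polish space with its Borel $\sigma$-algebra, $\mu$ a probability measure on $\mathsf X$, $(M_n)_{n\ge1}$ Markov kernels on $\mathsf X$ and $(G_n)_{n\ge0}$ measurable functions $\mathsf X\to(0,\infty)$. Put $Q_n(x,dx'):=G_{n-1}(x)M_n(x,dx')$ and let $\mathbb E_\mu$ be the expectation under the law of the Markov chain $(X_n)_{n\ge0}$ with $X_0\sim\mu$ and $X_n\mid\{X_{n-1}=x\}\sim M_n(x,\cdot)$. For $v:\mathsf X\to[1,\infty)$ let $\|\varphi\|_v:=\sup_x|\varphi(x)|/v(x)$ and let $\mathcal P_v$ be the set of probability measures $\eta$ on $\mathsf X$ with $\eta(v):=\int v\,d\eta<\infty$. Assume: (H1) There are a measurable unbounded $V:\mathsf X\to[1,\infty)$ and constants $\delta>0$, $\underline d\ge1$ such that for each $d\in[\underline d,\infty)$ there is $b_d\in\mathbb R$ with, writing $C_d:=\{x:V(x)\le d\}$, $$\sup_{n\ge1}Q_n(e^V)(x)\le \exp\big(V(x)(1-\delta)+b_d\mathbb I_{C_d}(x)\big)\quad\text{for all }x\in\mathsf X.$$ (H2) $\mu\in\mathcal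 P_v$, where $v:=e^V$. (H3) For each $d\in[\underline d,\infty)$: $Q_n(x,C_d)>0$ for all $x\in\mathsf X$ and $n\ge1$, and there are $\epsilon_d^->0$ and $\nu_d\in\mathcal P_v$, with $\nu_d(C_r)>0$ for all $r\in[\underline d,d]$, such that $\inf_{n\ge1}Q_n(x,C_d\cap A)\ge\epsilon_d^-\nu_d(C_d\cap A)$ for all $x\in C_d$ and all Borel $A$. (H4) For each $d\in[\underline d,\infty)$ there is $\epsilon_d^+\in[\epsilon_d^-,\infty)$ such that $\sup_{n\ge1}Q_n(x,C_d\cap A)\le\epsilon_d^+\nu_d(C_d\cap A)$ for all $x\in C_d$ and all Borel $A$. Then there is a finite constant $c_\mu$, depending only on $\mu$ and the quantities $V,\delta,\underline d,(b_d),(\epsilon_d^\pm),(\nu_d)$ in (H1)–(H4), such that for every collection of measurable functions $F_k:\mathsf X\to\mathbb R$, $k\ge0$, with $\sup_x(|F_k(x)|-\delta V(x))<\infty$ for each $k$, all $n\ge1$, all $0\le s\le n+1$ and all integers $0\le i_1<\dots<i_s\le n$, where in the case $\delta>1$ it is moreover required that $i_s<n$ (if $s\ge1$), one has $0<\mathbb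 E_\mu\big[\prod_{p=0}^{n-1}G_p(X_p)\big]<\infty$ and $$\frac{\mathbb E_\mu\Big[\prod_{p=0}^{n-1}G_p(X_p)\,\exp\Big(\sum_{k\in\{i_1,\dots,i_s\}}|F_k(X_k)|\Big)\Big]}{\mathbb E_\mu\Big[\prod_{p=0}^{n-1}G_p(X_p)\Big]}\le c_\mu^{\,s}\,\mu(v)\prod_{k\in\{i_1,\dots,i_s\}}\big\|e^{|F_k|}\big\|_{v^\delta},$$ where for $s=0$ the sum is $0$ and the product is $1$. -/

import Mathlib

open MeasureTheory ProbabilityTheory Set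
open scoped ENNReal NNReal

noncomputable section

namespace FeynmanKac

/-- The sublevel set `C_d = {x : V x ≤ d}`. -/
def sublevel {X : Type*} (V : X → ℝ) (d : ℝ) : Set X := {x | V x ≤ d}

/-- The weighted supremum norm `‖φ‖_w = sup_x |φ x| / w x`, with value `∞` if the supremum is
infinite. -/
def weightedNorm {X : Type*} (w φ : X → ℝ) : ℝ≥0∞ := ⨆ x, ENNReal.ofReal (|φ x| / w x)

/-- The index set `I_{n,s}` of tuples `0 ≤ i_1 < ... < i_s ≤ n`. -/
def indexTuples (n s : ℕ) : Set (Fin s → ℕ) := {i | StrictMono i ∧ ∀ j, i j ≤ n}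

variable {X : Type*} [MeasurableSpace X]

/-- `η` belongs to `P_v`: it is a probability measure and `η(v) < ∞`. -/
def MemPv (v : X → ℝ) (η : Measure X) : Prop :=
  IsProbabilityMeasure η ∧ ∫⁻ x, ENNReal.ofReal (v x) ∂η < ∞

/-- `Q_n(x, dx') = G_{n-1}(x) M_n(x, dx')`; only the indices `n ≥ 1` are meant. -/
def Q (M : ℕ → Kernel X X) (G : ℕ → X → ℝ) (n : ℕ) (x : X) : Measure X :=
  ENNReal.ofReal (G (n - 1) x) • M n x

/-- The multiplicative drift condition (H1) for `V`, `δ`, `d_` and the constants `b_d`, `d ≥ d_`. -/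
structure DriftCondition (M : ℕ → Kernel X X) (G : ℕ → X → ℝ)
    (V : X → ℝ) (δ dmin : ℝ) (b : ℝ → ℝ) : Prop where
  measurable_V : Measurable V
  one_le_V : ∀ x, 1 ≤ V x
  unbounded_V : ¬ BddAbove (range V)
  delta_pos : 0 < δ
  one_le_dmin : 1 ≤ dmin
  drift : ∀ d, dmin ≤ d → ∀ n, 1 ≤ n → ∀ x,
    ∫⁻ y, ENNReal.ofReal (Real.exp (V y)) ∂(Q M G n x) ≤
      ENNReal.ofReal (Real.exp (V x * (1 - δ) + b d * (sublevel V d).indicator 1 x))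

/-- The local minorization condition (H3). -/
structure MinorizationCondition (M : ℕ → Kernel X X) (G : ℕ → X → ℝ)
    (V : X → ℝ) (dmin : ℝ) (εminus : ℝ → ℝ) (ν : ℝ → Measure X) : Prop where
  accessible : ∀ d, dmin ≤ d → ∀ n, 1 ≤ n → ∀ x, 0 < Q M G n x (sublevel V d)
  eps_pos : ∀ d, dmin ≤ d → 0 < εminus d
  nu_mem : ∀ d, dmin ≤ d → MemPv (fun x => Real.exp (V x)) (ν d)
  minor : ∀ d, dmin ≤ d → ∀ n, 1 ≤ n → ∀ x ∈ sublevel V d, ∀ A, MeasurableSet A →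
    ENNReal.ofReal (εminus d) * ν d (sublevel V d ∩ A) ≤ Q M G n x (sublevel V d ∩ A)
  nu_pos : ∀ d, dmin ≤ d → ∀ r ∈ Icc dmin d, 0 < ν d (sublevel V r)

/-- The local majorization condition (H4). -/
structure MajorizationCondition (M : ℕ → Kernel X X) (G : ℕ → X → ℝ)
    (V : X → ℝ) (dmin : ℝ) (εminus εplus : ℝ → ℝ) (ν : ℝ → Measure X) : Prop where
  eps_le : ∀ d, dmin ≤ d → εminus d ≤ εplus d
  major : ∀ d, dmin ≤ d → ∀ n, 1 ≤ n → ∀ x ∈ sublevel V d, ∀ A, MeasurableSet A →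
    Q M G n x (sublevel V d ∩ A) ≤ ENNReal.ofReal (εplus d) * ν d (sublevel V d ∩ A)

/-- The one-step transition from the history up to time `n` to time `n + 1`: it is `M_{n+1}`
evaluated at the time-`n` coordinate. -/
def step (M : ℕ → Kernel X X) (n : ℕ) : Kernel ((_ : Finset.Iic n) → X) X :=
  (M (n + 1)).comap (fun y => y ⟨n, Finset.mem_Iic.2 le_rfl⟩) (measurable_pi_apply _)

instance (M : ℕ → Kernel X X) [∀ n, IsMarkovKernel (M n)] (n : ℕ) :
    IsMarkovKernel (step M n) := by
  unfold step; infer_instance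

/-- The canonical law on path space of the non-homogeneous Markov chain with `X_0 ∼ μ` and
`X_n | X_{n-1} = x ∼ M_n(x, ·)`. -/
def pathLaw (μ : Measure X) (M : ℕ → Kernel X X) [∀ n, IsMarkovKernel (M n)] :
    Measure (ℕ → X) :=
  Kernel.trajMeasure (X := fun _ => X) μ (step M)

/-- `E_μ[∏_{p=0}^{n-1} G_p(X_p) Φ(X_0, X_1, ...)]` for a nonnegative path functional `Φ`. -/
def weightedExpectation (μ : Measure X) (M : ℕ → Kernel X X) [∀ n, IsMarkovKernel (M n)]
    (G : ℕ → X → ℝ) (n : ℕ) (Φ : (ℕ → X) → ℝ) : ℝ≥0∞ :=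
  ∫⁻ ω, ENNReal.ofReal ((∏ p ∈ Finset.range n, G p (ω p)) * Φ ω) ∂(pathLaw μ M)

end FeynmanKac

end

/-!
Let `γ_n` be the unnormalized Feynman-Kac flow and `v = e^V`. The drift condition says
`K_n v ≤ B v^{1-δ}`, so `K_n` contracts `v` off high level sets, while a level set of positive
initial mass regenerates a fixed proportion of its mass at each step. Hence `γ_n(v)` is bounded by a
multiple of the mass `γ_n(C_r)`, and therefore `γ_n(1) ≤ T γ_{n+1}(1)`.

Consequently the normalized semigroup `K_p ⋯ K_{p+k-1} v · γ_p(1) / γ_{p+k}(1)` is at most `S v`.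
From a point of a level set `D`, the part of the first step that stays in `D` is comparable with the
same step taken from `γ_p`, and the part that leaves `D` meets the contraction.

Inserting a factor `e^{|F_p|} ≤ ‖e^{|F_p|}‖ v^δ` at time `p` costs only a constant, because
`v^δ K_p v ≤ B v`. The normalized semigroup bound carries the estimate from one insertion to the
next.
-/

namespace FeynmanKac

section Flow

variable {X : Type*} [MeasurableSpace X]

/-- The unnormalized flow `γ_0 = μ`, `γ_{n+1} = γ_n K_n` of a sequence of kernels. For
`K_n = Q_{n+1}` these are the unnormalized Feynman-Kac measures. -/
noncomputable def flow (μ : Measure X) (K : ℕ → Kernel X X) : ℕ → Measure X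
  | 0 => μ
  | n + 1 => (flow μ K n).bind (K n)

/-- The backward semigroup of a sequence of kernels, with the number of steps `k` before the
starting time `p`: `semigroup K f k p = K_p K_{p+1} ⋯ K_{p+k-1} f`. -/
noncomputable def semigroup (K : ℕ → Kernel X X) (f : X → ℝ≥0∞) : ℕ → ℕ → X → ℝ≥0∞
  | 0, _ => f
  | k + 1, p => fun x => ∫⁻ y, semigroup K f k (p + 1) y ∂(K p x)

variable {μ : Measure X} {K : ℕ → Kernel X X} {v : X → ℝ≥0∞}

lemma lintegral_flow_succ (n : ℕ) {f : X → ℝ≥0∞} (hf : Measurable f) :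
    ∫⁻ x, f x ∂(flow μ K (n + 1)) = ∫⁻ x, ∫⁻ y, f y ∂(K n x) ∂(flow μ K n) :=
  Measure.lintegral_bind (K n).measurable.aemeasurable hf.aemeasurable

lemma measurable_semigroup {f : X → ℝ≥0∞} (hf : Measurable f) (k p : ℕ) :
    Measurable (semigroup K f k p) := by
  induction k generalizing p with
  | zero => exact hf
  | succ k ih => exact (ih (p + 1)).lintegral_kernel

lemma lintegral_semigroup_flow_succ {f : X → ℝ≥0∞} (hf : Measurable f) (k p : ℕ) :
    ∫⁻ x, semigroup K f k (p + 1) x ∂(flow μ K (p + 1)) =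
      ∫⁻ x, semigroup K f (k + 1) p x ∂(flow μ K p) :=
  lintegral_flow_succ p (measurable_semigroup hf k (p + 1))

lemma lintegral_semigroup_flow {f : X → ℝ≥0∞} (hf : Measurable f) (k p : ℕ) :
    ∫⁻ x, semigroup K f k p x ∂(flow μ K p) = ∫⁻ x, f x ∂(flow μ K (p + k)) := by
  induction k generalizing p with
  | zero => rfl
  | succ k ih => rw [← lintegral_semigroup_flow_succ hf, ih, Nat.add_right_comm, Nat.add_assoc]

lemma flow_le_mul_flow_succ {α : ℝ≥0∞} {s t : Set X} (hs : MeasurableSet s)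
    (ht : MeasurableSet t) {n : ℕ} (h : ∀ x ∈ s, 1 ≤ α * K n x t) :
    flow μ K n s ≤ α * flow μ K (n + 1) t :=
  calc flow μ K n s = ∫⁻ _ in s, 1 ∂(flow μ K n) := (setLIntegral_one s).symm
    _ ≤ ∫⁻ x in s, α * K n x t ∂(flow μ K n) := setLIntegral_mono' hs h
    _ ≤ ∫⁻ x, α * K n x t ∂(flow μ K n) := setLIntegral_le_lintegral _ _
    _ = α * flow μ K (n + 1) t := by
      rw [lintegral_const_mul _ ((K n).measurable_coe ht), flow,
        Measure.bind_apply ht (K n).measurable.aemeasurable]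

lemma measure_le_lintegral (hv1 : ∀ x, 1 ≤ v x) (η : Measure X) (s : Set X) :
    η s ≤ ∫⁻ x, v x ∂η :=
  calc η s ≤ η univ := measure_mono (subset_univ s)
    _ = ∫⁻ _, 1 ∂η := lintegral_one.symm
    _ ≤ ∫⁻ x, v x ∂η := lintegral_mono hv1

lemma lintegral_flow_le_mul_flow (hv : Measurable v) {C D : Set X} (hC : MeasurableSet C)
    (hD : MeasurableSet D) {ρ L α β R : ℝ≥0∞}
    (hdrift : ∀ n x, ∫⁻ y, v y ∂(K n x) ≤ ρ * v x + L * D.indicator 1 x)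
    (hα : ∀ n, ∀ x ∈ C, 1 ≤ α * K n x C) (hβ : ∀ n, ∀ x ∈ D, 1 ≤ β * K n x C)
    (hμ : ∫⁻ x, v x ∂μ ≤ R * μ C) (hR : ρ * R * α + L * β ≤ R) (n : ℕ) :
    ∫⁻ x, v x ∂(flow μ K n) ≤ R * flow μ K n C := by
  induction n with
  | zero => exact hμ
  | succ n ih =>
    calc ∫⁻ x, v x ∂(flow μ K (n + 1))
        ≤ ∫⁻ x, (ρ * v x + L * D.indicator 1 x) ∂(flow μ K n) := by
          rw [lintegral_flow_succ n hv]
          exact lintegral_mono (hdrift n)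
      _ = ρ * ∫⁻ x, v x ∂(flow μ K n) + L * flow μ K n D := by
          rw [lintegral_add_left (hv.const_mul ρ), lintegral_const_mul _ hv,
            lintegral_const_mul _ (measurable_one.indicator hD), lintegral_indicator_one hD]
      _ ≤ ρ * (R * flow μ K n C) + L * flow μ K n D := by gcongr
      _ ≤ ρ * (R * (α * flow μ K (n + 1) C)) + L * (β * flow μ K (n + 1) C) := by
          gcongr
          · exact flow_le_mul_flow_succ hC hC (hα n)
          · exact flow_le_mul_flow_succ hD hC (hβ n)
      _ = (ρ * R * α + L * β) * flow μ K (n + 1) C := by ring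
      _ ≤ R * flow μ K (n + 1) C := by gcongr

lemma flow_univ_le_mul_flow_univ_succ (hv1 : ∀ x, 1 ≤ v x) {C : Set X} (hC : MeasurableSet C)
    {α R : ℝ≥0∞} {n : ℕ} (hα : ∀ x ∈ C, 1 ≤ α * K n x C)
    (hR : ∫⁻ x, v x ∂(flow μ K n) ≤ R * flow μ K n C) :
    flow μ K n univ ≤ R * α * flow μ K (n + 1) univ :=
  calc flow μ K n univ ≤ R * flow μ K n C := (measure_le_lintegral hv1 _ _).trans hR
    _ ≤ R * (α * flow μ K (n + 1) C) := by gcongr; exact flow_le_mul_flow_succ hC hC hα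
    _ ≤ R * (α * flow μ K (n + 1) univ) := by gcongr; exact subset_univ C
    _ = R * α * flow μ K (n + 1) univ := (mul_assoc _ _ _).symm

lemma flow_univ_ne_zero (hμ : μ ≠ 0) {T : ℝ≥0∞}
    (hT : ∀ n, flow μ K n univ ≤ T * flow μ K (n + 1) univ) (n : ℕ) :
    flow μ K n univ ≠ 0 := by
  induction n with
  | zero => exact Measure.measure_univ_ne_zero.2 hμ
  | succ n ih => exact fun h => ih (le_antisymm ((hT n).trans_eq (by rw [h, mul_zero])) zero_le)

lemma lintegral_flow_ne_top (hv : Measurable v) {B : ℝ≥0∞} (hB : B ≠ ∞)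
    (hK : ∀ n x, ∫⁻ y, v y ∂(K n x) ≤ B * v x) (hμ : ∫⁻ x, v x ∂μ ≠ ∞) (n : ℕ) :
    ∫⁻ x, v x ∂(flow μ K n) ≠ ∞ := by
  induction n with
  | zero => exact hμ
  | succ n ih =>
    refine ne_top_of_le_ne_top (ENNReal.mul_ne_top hB ih) ?_
    rw [lintegral_flow_succ n hv, ← lintegral_const_mul _ hv]
    exact lintegral_mono (hK n)

lemma setLIntegral_mul_flow_le {D : Set X} (hD : MeasurableSet D) {κ : ℝ≥0∞} {n : ℕ} {x : X}
    (hκ : ∀ y ∈ D, (K n x).restrict D ≤ κ • (K n y).restrict D) {f : X → ℝ≥0∞}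
    (hf : Measurable f) :
    (∫⁻ z in D, f z ∂(K n x)) * flow μ K n D ≤ κ * ∫⁻ z, f z ∂(flow μ K (n + 1)) :=
  calc (∫⁻ z in D, f z ∂(K n x)) * flow μ K n D
      = ∫⁻ _ in D, ∫⁻ z in D, f z ∂(K n x) ∂(flow μ K n) := (setLIntegral_const _ _).symm
    _ ≤ ∫⁻ y in D, κ * ∫⁻ z, f z ∂(K n y) ∂(flow μ K n) := by
      refine setLIntegral_mono' hD fun y hy => ?_
      calc ∫⁻ z in D, f z ∂(K n x) ≤ ∫⁻ z, f z ∂(κ • (K n y).restrict D) :=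
            lintegral_mono' (hκ y hy) le_rfl
        _ = κ * ∫⁻ z in D, f z ∂(K n y) := lintegral_smul_measure _ _
        _ ≤ κ * ∫⁻ z, f z ∂(K n y) := by gcongr; exact Measure.restrict_le_self
    _ ≤ ∫⁻ y, κ * ∫⁻ z, f z ∂(K n y) ∂(flow μ K n) := setLIntegral_le_lintegral _ _
    _ = κ * ∫⁻ z, f z ∂(flow μ K (n + 1)) := by
      rw [lintegral_const_mul _ hf.lintegral_kernel, lintegral_flow_succ n hf]

lemma setLIntegral_semigroup_mul_flow_univ_le (hv : Measurable v) (hv1 : ∀ x, 1 ≤ v x) {D : Set X}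
    (hD : MeasurableSet D) {κ R : ℝ≥0∞} (hR : ∀ n, ∫⁻ x, v x ∂(flow μ K n) ≤ R * flow μ K n D)
    {p : ℕ} {x : X} (hκ : ∀ y ∈ D, (K p x).restrict D ≤ κ • (K p y).restrict D) (k : ℕ) :
    (∫⁻ y in D, semigroup K v k (p + 1) y ∂(K p x)) * flow μ K p univ ≤
      κ * R * R * flow μ K (p + (k + 1)) univ :=
  calc (∫⁻ y in D, semigroup K v k (p + 1) y ∂(K p x)) * flow μ K p univ
      ≤ (∫⁻ y in D, semigroup K v k (p + 1) y ∂(K p x)) * (R * flow μ K p D) :=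
        mul_le_mul_right ((measure_le_lintegral hv1 _ _).trans (hR p)) _
    _ = R * ((∫⁻ y in D, semigroup K v k (p + 1) y ∂(K p x)) * flow μ K p D) := by ring
    _ ≤ R * (κ * ∫⁻ y, semigroup K v k (p + 1) y ∂(flow μ K (p + 1))) := by
        gcongr R * ?_
        exact setLIntegral_mul_flow_le hD hκ (measurable_semigroup hv _ _)
    _ = R * (κ * ∫⁻ y, v y ∂(flow μ K (p + (k + 1)))) := by
        rw [lintegral_semigroup_flow_succ hv, lintegral_semigroup_flow hv]
    _ ≤ R * (κ * (R * flow μ K (p + (k + 1)) univ)) := by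
        gcongr R * (κ * ?_)
        exact (hR _).trans (by gcongr; exact subset_univ D)
    _ = κ * R * R * flow μ K (p + (k + 1)) univ := by ring

lemma semigroup_mul_flow_univ_le {w : X → ℝ≥0∞} (hv : Measurable v) (hv1 : ∀ x, 1 ≤ v x)
    (hw : Measurable w) {D : Set X} (hD : MeasurableSet D) {κ R T S : ℝ≥0∞}
    (hκ : ∀ n, ∀ x ∈ D, ∀ y ∈ D, (K n x).restrict D ≤ κ • (K n y).restrict D)
    (hR : ∀ n, ∫⁻ x, v x ∂(flow μ K n) ≤ R * flow μ K n D)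
    (hT : ∀ n, flow μ K n univ ≤ T * flow μ K (n + 1) univ)
    (hvw : ∀ x, v x ≤ S * w x) (hw1 : ∀ x ∈ D, 1 ≤ w x)
    (hin : ∀ n, ∀ x ∈ D, T * ∫⁻ y in Dᶜ, w y ∂(K n x) ≤ 2⁻¹ * w x)
    (hout : ∀ n, ∀ x ∉ D, T * ∫⁻ y, w y ∂(K n x) ≤ w x)
    (hS : κ * R * R ≤ 2⁻¹ * S) (k p : ℕ) (x : X) :
    semigroup K v k p x * flow μ K p univ ≤ S * w x * flow μ K (p + k) univ := by
  induction k generalizing p x with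
  | zero => exact mul_le_mul_left (hvw x) _
  | succ k ih =>
    set f := semigroup K v k (p + 1)
    have hf : Measurable f := measurable_semigroup hv k (p + 1)
    set g := flow μ K (p + (k + 1)) univ
    have hstep (y : X) : f y * flow μ K p univ ≤ S * g * T * w y :=
      calc f y * flow μ K p univ ≤ f y * (T * flow μ K (p + 1) univ) := by gcongr; exact hT p
        _ = T * (f y * flow μ K (p + 1) univ) := by ring
        _ ≤ T * (S * w y * flow μ K (p + 1 + k) univ) := by gcongr T * ?_; exact ih (p + 1) y
        _ = S * g * T * w y := by rw [Nat.add_assoc, Nat.add_comm 1 k]; ring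
    have hset (s : Set X) :
        (∫⁻ y in s, f y ∂(K p x)) * flow μ K p univ ≤ S * g * (T * ∫⁻ y in s, w y ∂(K p x)) := by
      rw [← lintegral_mul_const _ hf, ← mul_assoc, ← lintegral_const_mul _ hw]
      exact lintegral_mono hstep
    change (∫⁻ y, f y ∂(K p x)) * flow μ K p univ ≤ _
    by_cases hx : x ∈ D
    · calc (∫⁻ y, f y ∂(K p x)) * flow μ K p univ
          = (∫⁻ y in D, f y ∂(K p x)) * flow μ K p univ +
              (∫⁻ y in Dᶜ, f y ∂(K p x)) * flow μ K p univ := by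
            rw [← lintegral_add_compl _ hD, add_mul]
        _ ≤ κ * R * R * g + S * g * (T * ∫⁻ y in Dᶜ, w y ∂(K p x)) := by
            gcongr ?_ + ?_
            · exact setLIntegral_semigroup_mul_flow_univ_le hv hv1 hD hR (hκ p x hx) k
            · exact hset Dᶜ
        _ ≤ 2⁻¹ * S * g * w x + S * g * (2⁻¹ * w x) := by
            gcongr ?_ + S * g * ?_
            · exact (mul_le_mul_left hS g).trans (le_mul_of_one_le_right' (hw1 x hx))
            · exact hin p x hx
        _ = (2⁻¹ + 2⁻¹) * (S * w x * g) := by ring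
        _ = S * w x * g := by rw [ENNReal.inv_two_add_inv_two, one_mul]
    · calc (∫⁻ y, f y ∂(K p x)) * flow μ K p univ ≤ S * g * (T * ∫⁻ y, w y ∂(K p x)) := by
            simpa only [setLIntegral_univ] using hset univ
        _ ≤ S * g * w x := by gcongr; exact hout p x hx
        _ = S * w x * g := by ring

lemma semigroup_mul_flow_univ_le_of_drift (hv : Measurable v) (hv1 : ∀ x, 1 ≤ v x) {D : Set X}
    (hD : MeasurableSet D) {κ R T B a S : ℝ≥0∞}
    (hκ : ∀ n, ∀ x ∈ D, ∀ y ∈ D, (K n x).restrict D ≤ κ • (K n y).restrict D)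
    (hR : ∀ n, ∫⁻ x, v x ∂(flow μ K n) ≤ R * flow μ K n D)
    (hT : ∀ n, flow μ K n univ ≤ T * flow μ K (n + 1) univ)
    (hB : ∀ n x, ∫⁻ y, v y ∂(K n x) ≤ B * v x)
    (ha : ∀ n, ∀ x ∉ D, T * ∫⁻ y, v y ∂(K n x) ≤ a * v x) (ha1 : a ≤ 1)
    (haB : T * B * a ≤ 2⁻¹) (haS : 1 ≤ S * a) (hS : κ * R * R ≤ 2⁻¹ * S) (k p : ℕ) (x : X) :
    semigroup K v k p x * flow μ K p univ ≤ S * v x * flow μ K (p + k) univ := by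
  classical
  -- Lowering the weight to `a v` off `D` makes excursions from `D` cheap, while `ha` lets it
  -- survive a step started off `D`.
  set w : X → ℝ≥0∞ := D.piecewise v fun y => a * v y
  have hw_in (y : X) (hy : y ∈ D) : w y = v y := D.piecewise_eq_of_mem _ _ hy
  have hw_out (y : X) (hy : y ∉ D) : w y = a * v y := D.piecewise_eq_of_notMem _ _ hy
  have hwv (y : X) : w y ≤ v y :=
    D.piecewise_le (fun _ _ => le_rfl) (fun _ _ => mul_le_of_le_one_left' ha1) y
  have hvw (y : X) : v y ≤ S * w y := by
    by_cases hy : y ∈ D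
    · rw [hw_in y hy]
      exact le_mul_of_one_le_left' (haS.trans (mul_le_of_le_one_right' ha1))
    · rw [hw_out y hy, ← mul_assoc]
      exact le_mul_of_one_le_left' haS
  have hin (n : ℕ) (y : X) (hy : y ∈ D) : T * ∫⁻ z in Dᶜ, w z ∂(K n y) ≤ 2⁻¹ * w y :=
    calc T * ∫⁻ z in Dᶜ, w z ∂(K n y) = T * (a * ∫⁻ z in Dᶜ, v z ∂(K n y)) := by
          rw [setLIntegral_congr_fun hD.compl hw_out, lintegral_const_mul _ hv]
      _ ≤ T * (a * (B * v y)) := by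
          gcongr T * (a * ?_)
          exact (setLIntegral_le_lintegral _ _).trans (hB n y)
      _ = T * B * a * v y := by ring
      _ ≤ 2⁻¹ * w y := by rw [hw_in y hy]; gcongr
  have hout (n : ℕ) (y : X) (hy : y ∉ D) : T * ∫⁻ z, w z ∂(K n y) ≤ w y :=
    calc T * ∫⁻ z, w z ∂(K n y) ≤ T * ∫⁻ z, v z ∂(K n y) := by gcongr with z; exact hwv z
      _ ≤ w y := (ha n y hy).trans_eq (hw_out y hy).symm
  calc semigroup K v k p x * flow μ K p univ ≤ S * w x * flow μ K (p + k) univ :=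
        semigroup_mul_flow_univ_le hv hv1 (hv.piecewise hD (hv.const_mul a)) hD hκ hR hT hvw
          (fun y hy => (hv1 y).trans_eq (hw_in y hy).symm) hin hout hS k p x
    _ ≤ S * v x * flow μ K (p + k) univ := by gcongr; exact hwv x

lemma lintegral_semigroup_flow_perturbed_le {K' : ℕ → Kernel X X} (hv : Measurable v)
    [IsProbabilityMeasure μ] {S T : ℝ≥0∞}
    (hS : ∀ k p x, semigroup K v k p x * flow μ K p univ ≤ S * v x * flow μ K (p + k) univ)
    (hT : ∀ n, flow μ K n univ ≤ T * flow μ K (n + 1) univ) (hfin : ∀ n, flow μ K n univ ≠ ∞)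
    (I : Finset ℕ) {b : ℕ → ℝ≥0∞} (hK' : ∀ p ∉ I, K' p = K p)
    (hb : ∀ p ∈ I, ∀ x, ∫⁻ y, v y ∂(K' p x) ≤ b p * v x) (n k : ℕ) :
    ∫⁻ x, semigroup K v k n x ∂(flow μ K' n) ≤
      S * (∏ p ∈ Finset.range n, if p ∈ I then S * T * b p else 1) * (∫⁻ x, v x ∂μ) *
        flow μ K (n + k) univ := by
  induction n generalizing k with
  | zero =>
    calc ∫⁻ x, semigroup K v k 0 x ∂μ ≤ ∫⁻ x, S * flow μ K (0 + k) univ * v x ∂μ := by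
          refine lintegral_mono fun x => ?_
          simpa only [flow, measure_univ, mul_one, mul_right_comm] using hS k 0 x
      _ = _ := by rw [lintegral_const_mul _ hv, Finset.prod_range_zero]; ring
  | succ n ih =>
    set P := ∏ p ∈ Finset.range n, if p ∈ I then S * T * b p else 1
    set g := flow μ K (n + 1 + k) univ
    rw [lintegral_flow_succ n (measurable_semigroup hv k (n + 1)), Finset.prod_range_succ]
    by_cases hn : n ∈ I
    · have hone : ∫⁻ x, v x ∂(flow μ K' n) ≤ S * P * (∫⁻ x, v x ∂μ) * flow μ K n univ := ih 0
      rw [if_pos hn, ← ENNReal.mul_le_mul_iff_left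
        (flow_univ_ne_zero (IsProbabilityMeasure.ne_zero μ) hT (n + 1)) (hfin (n + 1)),
        ← lintegral_flow_succ n (measurable_semigroup hv k (n + 1)),
        ← lintegral_mul_const _ (measurable_semigroup hv k (n + 1))]
      calc ∫⁻ x, semigroup K v k (n + 1) x * flow μ K (n + 1) univ ∂(flow μ K' (n + 1))
          ≤ ∫⁻ x, S * g * v x ∂(flow μ K' (n + 1)) :=
            lintegral_mono fun x => (hS k (n + 1) x).trans_eq (mul_right_comm _ _ _)
        _ = S * g * ∫⁻ x, ∫⁻ y, v y ∂(K' n x) ∂(flow μ K' n) := by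
            rw [lintegral_const_mul _ hv, lintegral_flow_succ n hv]
        _ ≤ S * g * (b n * ∫⁻ x, v x ∂(flow μ K' n)) := by
            rw [← lintegral_const_mul _ hv]
            gcongr with x
            exact hb n hn x
        _ ≤ S * g * (b n * (S * P * (∫⁻ x, v x ∂μ) * (T * flow μ K (n + 1) univ))) := by
            gcongr
            exact hone.trans (by gcongr; exact hT n)
        _ = _ := by ring
    · rw [if_neg hn, mul_one, hK' n hn]
      exact (ih (k + 1)).trans_eq (by rw [← Nat.add_assoc, Nat.add_right_comm])

end Flow

section LocallyControlled

variable {X : Type*} [MeasurableSpace X]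

/-- The weight `v = e^V`, valued in `[0, ∞]`. -/
noncomputable def expWeight {Y : Type*} (V : Y → ℝ) (x : Y) : ℝ≥0∞ :=
  ENNReal.ofReal (Real.exp (V x))

/-- What (H1), (H3) and (H4) say about the kernels `K_n = Q_{n+1}` once the reference measures `ν_d`
are eliminated: the drift `K_n v ≤ B v^{1-δ}` for `v = e^V`, a lower bound `1 / α d r` on the mass
sent from `C_d` to `C_r`, and comparability up to the factor `κ d` of the kernels restricted to
`C_d`. -/
structure LocallyControlled (K : ℕ → Kernel X X) (V : X → ℝ) (δ dmin : ℝ) (B : ℝ≥0)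
    (α : ℝ → ℝ → ℝ≥0) (κ : ℝ → ℝ≥0) : Prop where
  measurable : Measurable V
  nonneg : ∀ x, 0 ≤ V x
  drift : ∀ n x, ∫⁻ y, expWeight V y ∂(K n x) ≤ B * ENNReal.ofReal (Real.exp (V x * (1 - δ)))
  reach : ∀ d r, dmin ≤ r → r ≤ d → ∀ n, ∀ x ∈ sublevel V d, 1 ≤ α d r * K n x (sublevel V r)
  comparable : ∀ d, dmin ≤ d → ∀ n, ∀ x ∈ sublevel V d, ∀ y ∈ sublevel V d,
    (K n x).restrict (sublevel V d) ≤ (κ d : ℝ≥0∞) • (K n y).restrict (sublevel V d)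

lemma sublevel_mono {Y : Type*} (V : Y → ℝ) : Monotone (sublevel V) :=
  fun _ _ h _ hx => le_trans hx h

lemma measurableSet_sublevel {V : X → ℝ} (hV : Measurable V) (d : ℝ) :
    MeasurableSet (sublevel V d) := measurableSet_le hV measurable_const

lemma measurable_expWeight {V : X → ℝ} (hV : Measurable V) : Measurable (expWeight V) :=
  hV.exp.ennreal_ofReal

lemma one_le_expWeight {Y : Type*} {V : Y → ℝ} {x : Y} (hx : 0 ≤ V x) : 1 ≤ expWeight V x :=
  ENNReal.one_le_ofReal.2 (Real.one_le_exp hx)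

lemma exists_measure_sublevel_ne_zero {μ : Measure X} (hμ : μ ≠ 0) (V : X → ℝ) (d₀ : ℝ) :
    ∃ d, d₀ ≤ d ∧ μ (sublevel V d) ≠ 0 := by
  by_contra! h
  have hU : ⋃ n : ℕ, sublevel V (max d₀ n) = univ := eq_univ_of_forall fun x =>
    mem_iUnion.2 ((exists_nat_ge (V x)).imp fun _ hn => hn.trans (le_max_right _ _))
  exact hμ (Measure.measure_univ_eq_zero.1
    (hU ▸ measure_iUnion_null fun n => h _ (le_max_left _ _)))

lemma exists_mul_ofReal_exp_neg_le {δ : ℝ} (hδ : 0 < δ) {A ε : ℝ≥0∞} (hA : A ≠ ∞) (hε : ε ≠ 0)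
    (r : ℝ) : ∃ d, r ≤ d ∧ A * ENNReal.ofReal (Real.exp (-(δ * d))) ≤ ε := by
  have hexp : Filter.Tendsto (fun d : ℝ => Real.exp (-(δ * d))) Filter.atTop (nhds 0) :=
    Real.tendsto_exp_neg_atTop_nhds_zero.comp (Filter.tendsto_id.const_mul_atTop hδ)
  have hlim : Filter.Tendsto (fun d : ℝ => A * ENNReal.ofReal (Real.exp (-(δ * d)))) Filter.atTop
      (nhds 0) := by
    simpa only [ENNReal.ofReal_zero, mul_zero] using
      ENNReal.Tendsto.const_mul (ENNReal.tendsto_ofReal hexp) (.inr hA)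
  exact ((Filter.eventually_ge_atTop r).and
    (hlim.eventually (ge_mem_nhds (pos_iff_ne_zero.2 hε)))).exists

namespace LocallyControlled

variable {K : ℕ → Kernel X X} {V : X → ℝ} {δ dmin : ℝ} {B : ℝ≥0} {α : ℝ → ℝ → ℝ≥0} {κ : ℝ → ℝ≥0}

lemma rpow_mul_lintegral_le (h : LocallyControlled K V δ dmin B α κ) (n : ℕ) (x : X) :
    ENNReal.ofReal (Real.exp (V x) ^ δ) * ∫⁻ y, expWeight V y ∂(K n x) ≤ B * expWeight V x :=
  calc ENNReal.ofReal (Real.exp (V x) ^ δ) * ∫⁻ y, expWeight V y ∂(K n x)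
      ≤ ENNReal.ofReal (Real.exp (V x) ^ δ) *
          (B * ENNReal.ofReal (Real.exp (V x * (1 - δ)))) := by gcongr; exact h.drift n x
    _ = B * expWeight V x := by
      rw [mul_left_comm, ← ENNReal.ofReal_mul (by positivity), ← Real.exp_mul, ← Real.exp_add,
        ← mul_add, add_sub_cancel, mul_one, expWeight]

lemma lintegral_le_of_le (h : LocallyControlled K V δ dmin B α κ) (hδ : 0 ≤ δ) (n : ℕ) {d : ℝ}
    {x : X} (hx : d ≤ V x) :
    ∫⁻ y, expWeight V y ∂(K n x) ≤
      B * ENNReal.ofReal (Real.exp (-(δ * d))) * expWeight V x := by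
  refine (h.drift n x).trans ?_
  rw [mul_assoc, expWeight, ← ENNReal.ofReal_mul (Real.exp_pos _).le, ← Real.exp_add]
  gcongr
  linarith [mul_le_mul_of_nonneg_left hx hδ]

lemma lintegral_le (h : LocallyControlled K V δ dmin B α κ) (hδ : 0 ≤ δ) (n : ℕ) (x : X) :
    ∫⁻ y, expWeight V y ∂(K n x) ≤ B * expWeight V x := by
  simpa using h.lintegral_le_of_le hδ n (h.nonneg x)

lemma lintegral_le_add_indicator (h : LocallyControlled K V δ dmin B α κ) (hδ : 0 ≤ δ) (d : ℝ)
    (n : ℕ) (x : X) :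
    ∫⁻ y, expWeight V y ∂(K n x) ≤
      B * ENNReal.ofReal (Real.exp (-(δ * d))) * expWeight V x +
        B * ENNReal.ofReal (Real.exp d) * (sublevel V d).indicator 1 x := by
  by_cases hx : x ∈ sublevel V d
  · refine (h.lintegral_le hδ n x).trans (le_add_left ?_)
    rw [indicator_of_mem hx, Pi.one_apply, mul_one, expWeight]
    gcongr
    exact hx
  · exact (h.lintegral_le_of_le hδ n (not_le.1 hx).le).trans le_self_add

lemma exists_lintegral_flow_le_mul_flow {μ : Measure X} [IsFiniteMeasure μ] (hμ : μ ≠ 0)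
    (hμV : ∫⁻ x, expWeight V x ∂μ ≠ ∞) (hδ : 0 < δ) (dmin : ℝ) (B : ℝ≥0) (α : ℝ → ℝ → ℝ≥0)
    (κ : ℝ → ℝ≥0) :
    ∃ r, dmin ≤ r ∧ ∃ R : ℝ≥0, ∀ K, LocallyControlled K V δ dmin B α κ → ∀ n,
      ∫⁻ x, expWeight V x ∂(flow μ K n) ≤ R * flow μ K n (sublevel V r) := by
  obtain ⟨r, hr, hμr⟩ := exists_measure_sublevel_ne_zero hμ V dmin
  obtain ⟨d, hrd, hd⟩ := exists_mul_ofReal_exp_neg_le hδ (A := α r r * B) (ε := 2⁻¹)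
    (by finiteness) (by simp) r
  set ρ : ℝ≥0∞ := B * ENNReal.ofReal (Real.exp (-(δ * d)))
  set L : ℝ≥0∞ := B * ENNReal.ofReal (Real.exp d)
  obtain ⟨R, hR⟩ : ∃ R : ℝ≥0,
      (R : ℝ≥0∞) = 2 * (L * α d r) + (∫⁻ x, expWeight V x ∂μ) / μ (sublevel V r) :=
    ⟨_, ENNReal.coe_toNNReal (by finiteness)⟩
  have hinit : ∫⁻ x, expWeight V x ∂μ ≤ R * μ (sublevel V r) := by
    rw [hR, add_mul, ENNReal.div_mul_cancel hμr (measure_ne_top _ _)]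
    exact le_add_self
  have hinvariant : ρ * R * α r r + L * α d r ≤ R :=
    calc ρ * R * α r r + L * α d r = α r r * ρ * R + 2⁻¹ * (2 * (L * α d r)) := by
          rw [← mul_assoc 2⁻¹, ENNReal.inv_mul_cancel (by simp) (by simp), one_mul]
          ring
      _ ≤ 2⁻¹ * R + 2⁻¹ * R := by
          gcongr
          · rwa [← mul_assoc]
          · exact hR ▸ le_self_add
      _ = R := by rw [← add_mul, ENNReal.inv_two_add_inv_two, one_mul]
  exact ⟨r, hr, R, fun K h => lintegral_flow_le_mul_flow (measurable_expWeight h.measurable)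
    (measurableSet_sublevel h.measurable r) (measurableSet_sublevel h.measurable d)
    (h.lintegral_le_add_indicator hδ.le d) (h.reach r r hr le_rfl) (h.reach d r hr hrd)
    hinit hinvariant⟩

lemma exists_semigroup_mul_flow_univ_le (V : X → ℝ) (hδ : 0 < δ) (B : ℝ≥0) (α : ℝ → ℝ → ℝ≥0)
    (κ : ℝ → ℝ≥0) {r : ℝ} (hr : dmin ≤ r) (R T : ℝ≥0) :
    ∃ S : ℝ≥0, ∀ K, LocallyControlled K V δ dmin B α κ → ∀ μ : Measure X,
      (∀ n, ∫⁻ x, expWeight V x ∂(flow μ K n) ≤ R * flow μ K n (sublevel V r)) →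
      (∀ n, flow μ K n univ ≤ T * flow μ K (n + 1) univ) →
      ∀ k p x, semigroup K (expWeight V) k p x * flow μ K p univ ≤
        S * expWeight V x * flow μ K (p + k) univ := by
  set A : ℝ≥0∞ := 1 + T * B
  obtain ⟨d, hrd, hd⟩ := exists_mul_ofReal_exp_neg_le hδ (A := A * A) (ε := 2⁻¹)
    (by finiteness) (by simp) r
  set q : ℝ≥0∞ := ENNReal.ofReal (Real.exp (-(δ * d)))
  have hAa : A * (A * q) ≤ 2⁻¹ := by rwa [← mul_assoc]
  have ha0 : A * q ≠ 0 := mul_ne_zero (by simp [A]) (ENNReal.ofReal_pos.2 (Real.exp_pos _)).ne'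
  have ha1 : A * q ≤ 1 := (le_mul_of_one_le_left' le_self_add).trans (hAa.trans (by simp))
  obtain ⟨S, hS⟩ : ∃ S : ℝ≥0, (S : ℝ≥0∞) = (A * q)⁻¹ + 2 * (κ d * R * R) :=
    ⟨_, ENNReal.coe_toNNReal (by finiteness)⟩
  have haS : 1 ≤ S * (A * q) := by
    rw [hS, add_mul, ENNReal.inv_mul_cancel ha0 (by finiteness)]
    exact le_self_add
  have hκS : κ d * R * R ≤ 2⁻¹ * (S : ℝ≥0∞) := by
    rw [hS, mul_add, ← mul_assoc 2⁻¹ 2, ENNReal.inv_mul_cancel (by simp) (by simp), one_mul]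
    exact le_add_self
  refine ⟨S, fun K h μ hR hT => semigroup_mul_flow_univ_le_of_drift
    (measurable_expWeight h.measurable) (fun y => one_le_expWeight (h.nonneg y))
    (measurableSet_sublevel h.measurable d) (h.comparable d (hr.trans hrd))
    (fun n => (hR n).trans (by gcongr; exact sublevel_mono V hrd)) hT (h.lintegral_le hδ.le)
    (fun n y hy => ?_) ha1 ((mul_le_mul_left le_add_self _).trans hAa) haS hκS⟩
  calc T * ∫⁻ z, expWeight V z ∂(K n y) ≤ T * (B * q * expWeight V y) := by
        gcongr
        exact h.lintegral_le_of_le hδ.le n (not_le.1 hy).le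
    _ = T * B * q * expWeight V y := by ring
    _ ≤ A * q * expWeight V y := mul_le_mul_left (mul_le_mul_left le_add_self q) _

lemma exists_flow_univ_le_and_semigroup_mul_flow_univ_le {μ : Measure X} [IsFiniteMeasure μ]
    (hμ : μ ≠ 0) (hμV : ∫⁻ x, expWeight V x ∂μ ≠ ∞) (hδ : 0 < δ) (dmin : ℝ) (B : ℝ≥0)
    (α : ℝ → ℝ → ℝ≥0) (κ : ℝ → ℝ≥0) :
    ∃ S T : ℝ≥0, ∀ K, LocallyControlled K V δ dmin B α κ →
      (∀ n, flow μ K n univ ≤ T * flow μ K (n + 1) univ) ∧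
      ∀ k p x, semigroup K (expWeight V) k p x * flow μ K p univ ≤
        S * expWeight V x * flow μ K (p + k) univ := by
  obtain ⟨r, hr, R, hR⟩ := exists_lintegral_flow_le_mul_flow hμ hμV hδ dmin B α κ
  obtain ⟨S, hS⟩ := exists_semigroup_mul_flow_univ_le V hδ B α κ hr R (R * α r r)
  refine ⟨S, R * α r r, fun K h => ?_⟩
  have hT (n : ℕ) : flow μ K n univ ≤ (R * α r r : ℝ≥0) * flow μ K (n + 1) univ :=
    flow_univ_le_mul_flow_univ_succ (fun x => one_le_expWeight (h.nonneg x))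
      (measurableSet_sublevel h.measurable r) (h.reach r r hr le_rfl n) (hR K h n)
  exact ⟨hT, hS K h μ (hR K h) hT⟩

lemma flow_univ_ne_top {μ : Measure X} (h : LocallyControlled K V δ dmin B α κ) (hδ : 0 ≤ δ)
    (hμV : ∫⁻ x, expWeight V x ∂μ ≠ ∞) (n : ℕ) : flow μ K n univ ≠ ∞ :=
  ne_top_of_le_ne_top
    (lintegral_flow_ne_top (measurable_expWeight h.measurable) ENNReal.coe_ne_top
      (h.lintegral_le hδ) hμV n)
    (measure_le_lintegral (fun x => one_le_expWeight (h.nonneg x)) _ _)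

end LocallyControlled

end LocallyControlled

section PotentialKernel

variable {X : Type*} [MeasurableSpace X] {V : X → ℝ} {δ dmin : ℝ}

/-- The kernels `Q_{n+1}(x, dy) = G_n(x) M_{n+1}(x, dy)` of the Feynman-Kac model; the index is
shifted so that the sequence starts at `0`. -/
noncomputable def potentialKernel (M : ℕ → Kernel X X) [∀ n, IsSFiniteKernel (M n)]
    (G : ℕ → X → ℝ) (n : ℕ) : Kernel X X :=
  (M (n + 1)).withDensity fun x _ => ENNReal.ofReal (G n x)

section SFinite

variable (M : ℕ → Kernel X X) [∀ n, IsSFiniteKernel (M n)] {G : ℕ → X → ℝ}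

lemma potentialKernel_apply {n : ℕ} (hG : Measurable (G n)) (x : X) :
    potentialKernel M G n x = Q M G (n + 1) x := by
  rw [potentialKernel, Kernel.withDensity_apply _ (by fun_prop), withDensity_const, Q,
    Nat.add_sub_cancel]

lemma lintegral_potentialKernel {n : ℕ} (hG : Measurable (G n)) (x : X) (f : X → ℝ≥0∞) :
    ∫⁻ y, f y ∂(potentialKernel M G n x) =
      ENNReal.ofReal (G n x) * ∫⁻ y, f y ∂(M (n + 1) x) := by
  rw [potentialKernel_apply M hG, Q, lintegral_smul_measure, smul_eq_mul, Nat.add_sub_cancel]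

end SFinite

lemma ofReal_le_weightedNorm_mul {Y : Type*} {w φ : Y → ℝ} {x : Y} (hw : 0 < w x) :
    ENNReal.ofReal (φ x) ≤ weightedNorm w φ * ENNReal.ofReal (w x) :=
  calc ENNReal.ofReal (φ x) ≤ ENNReal.ofReal (|φ x| / w x) * ENNReal.ofReal (w x) := by
        rw [← ENNReal.ofReal_mul (by positivity), div_mul_cancel₀ _ hw.ne']
        exact ENNReal.ofReal_le_ofReal (le_abs_self _)
    _ ≤ weightedNorm w φ * ENNReal.ofReal (w x) := by
        gcongr
        exact le_iSup (fun x => ENNReal.ofReal (|φ x| / w x)) x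

lemma LocallyControlled.lintegral_potentialKernel_mul_le {M : ℕ → Kernel X X}
    [∀ n, IsSFiniteKernel (M n)] {G : ℕ → X → ℝ} {B : ℝ≥0} {α : ℝ → ℝ → ℝ≥0} {κ : ℝ → ℝ≥0}
    (h : LocallyControlled (potentialKernel M G) V δ dmin B α κ) {φ : ℕ → X → ℝ} {n : ℕ}
    (hG : Measurable (G n)) (hG0 : ∀ x, 0 ≤ G n x) (hφ : Measurable (φ n)) (x : X) :
    ∫⁻ y, expWeight V y ∂(potentialKernel M (fun p x => G p x * φ p x) n x) ≤
      B * weightedNorm (fun x => Real.exp (V x) ^ δ) (φ n) * expWeight V x :=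
  calc ∫⁻ y, expWeight V y ∂(potentialKernel M (fun p x => G p x * φ p x) n x)
      = ENNReal.ofReal (φ n x) * ∫⁻ y, expWeight V y ∂(potentialKernel M G n x) := by
        rw [lintegral_potentialKernel M (hG.mul hφ), lintegral_potentialKernel M hG,
          ENNReal.ofReal_mul (hG0 x)]
        ring
    _ ≤ weightedNorm (fun x => Real.exp (V x) ^ δ) (φ n) * ENNReal.ofReal (Real.exp (V x) ^ δ) *
          ∫⁻ y, expWeight V y ∂(potentialKernel M G n x) := by
        gcongr
        exact ofReal_le_weightedNorm_mul (w := fun x => Real.exp (V x) ^ δ) (by positivity)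
    _ ≤ weightedNorm (fun x => Real.exp (V x) ^ δ) (φ n) * (B * expWeight V x) := by
        rw [mul_assoc]
        exact mul_le_mul_right (h.rpow_mul_lintegral_le n x) _
    _ = B * weightedNorm (fun x => Real.exp (V x) ^ δ) (φ n) * expWeight V x := by ring

lemma locallyControlled_potentialKernel {M : ℕ → Kernel X X} [∀ n, IsSFiniteKernel (M n)]
    {G : ℕ → X → ℝ} (hG : ∀ n, Measurable (G n)) {b εminus εplus : ℝ → ℝ} {ν : ℝ → Measure X}
    (h1 : DriftCondition M G V δ dmin b) (h3 : MinorizationCondition M G V dmin εminus ν)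
    (h4 : MajorizationCondition M G V dmin εminus εplus ν) :
    LocallyControlled (potentialKernel M G) V δ dmin (Real.exp |b dmin|).toNNReal
      (fun d r => (ENNReal.ofReal (εminus d) * ν d (sublevel V r))⁻¹.toNNReal)
      (fun d => (εplus d / εminus d).toNNReal) where
  measurable := h1.measurable_V
  nonneg x := zero_le_one.trans (h1.one_le_V x)
  drift n x := by
    have hb : b dmin * (sublevel V dmin).indicator 1 x ≤ |b dmin| := by
      by_cases hx : x ∈ sublevel V dmin <;> simp [hx, le_abs_self]
    rw [potentialKernel_apply M (hG n)]
    refine (h1.drift dmin le_rfl (n + 1) n.succ_pos x).trans ?_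
    rw [← ENNReal.ofReal, ← ENNReal.ofReal_mul (Real.exp_pos _).le, ← Real.exp_add,
      add_comm |b dmin|]
    gcongr
  reach d r hr hrd n x hx := by
    have hd : dmin ≤ d := hr.trans hrd
    have : IsProbabilityMeasure (ν d) := (h3.nu_mem d hd).1
    have hne : ENNReal.ofReal (εminus d) * ν d (sublevel V r) ≠ 0 :=
      mul_ne_zero (ENNReal.ofReal_pos.2 (h3.eps_pos d hd)).ne' (h3.nu_pos d hd r ⟨hr, hrd⟩).ne'
    have hminor := h3.minor d hd (n + 1) n.succ_pos x hx _
      (measurableSet_sublevel h1.measurable_V r)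
    rw [inter_eq_right.2 (sublevel_mono V hrd)] at hminor
    rw [potentialKernel_apply M (hG n), ENNReal.coe_toNNReal (ENNReal.inv_ne_top.2 hne),
      ← ENNReal.inv_mul_cancel hne (by finiteness)]
    gcongr
  comparable d hd n x hx y hy := by
    refine Measure.le_iff.2 fun A hA => ?_
    rw [Measure.smul_apply, smul_eq_mul, Measure.restrict_apply hA, Measure.restrict_apply hA,
      inter_comm, potentialKernel_apply M (hG n), potentialKernel_apply M (hG n)]
    have hε : 0 < εminus d := h3.eps_pos d hd
    calc Q M G (n + 1) x (sublevel V d ∩ A)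
        ≤ ENNReal.ofReal (εplus d) * ν d (sublevel V d ∩ A) :=
          h4.major d hd (n + 1) n.succ_pos x hx A hA
      _ = ENNReal.ofReal (εplus d / εminus d) *
            (ENNReal.ofReal (εminus d) * ν d (sublevel V d ∩ A)) := by
          rw [← mul_assoc, ← ENNReal.ofReal_mul' hε.le, div_mul_cancel₀ _ hε.ne']
      _ ≤ ENNReal.ofReal (εplus d / εminus d) * Q M G (n + 1) y (sublevel V d ∩ A) := by
          gcongr
          exact h3.minor d hd (n + 1) n.succ_pos y hy A hA

end PotentialKernel

section PathLaw

variable {X : Type*} [MeasurableSpace X] (μ : Measure X) (M : ℕ → Kernel X X)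
  [∀ n, IsMarkovKernel (M n)]

lemma lintegral_pathLaw_zero {f : X → ℝ≥0∞} (hf : Measurable f) :
    ∫⁻ ω, f (ω 0) ∂(pathLaw μ M) = ∫⁻ x, f x ∂μ := by
  have hmap : (pathLaw μ M).map (Preorder.frestrictLe (π := fun _ => X) 0) =
      μ.map (MeasurableEquiv.piUnique (fun _ : Finset.Iic 0 => X)).symm := by
    rw [pathLaw, Kernel.trajMeasure, Measure.map_comp _ _ (by fun_prop),
      Kernel.traj_map_frestrictLe, Kernel.partialTraj_self, Measure.id_comp]
  calc ∫⁻ ω, f (ω 0) ∂(pathLaw μ M)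
      = ∫⁻ y, f (y ⟨0, Finset.mem_Iic.2 le_rfl⟩)
          ∂((pathLaw μ M).map (Preorder.frestrictLe (π := fun _ => X) 0)) := by
        rw [lintegral_map (by fun_prop) (by fun_prop)]
        rfl
    _ = ∫⁻ x, f x ∂μ := by
        rw [hmap, lintegral_map (by fun_prop) (MeasurableEquiv.measurable _)]
        rfl

variable [IsProbabilityMeasure μ]

lemma lintegral_pathLaw_succ (n : ℕ) {f : ((_ : Finset.Iic n) → X) → ℝ≥0∞} (hf : Measurable f)
    {g : X → ℝ≥0∞} (hg : Measurable g) :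
    ∫⁻ ω, f (Preorder.frestrictLe (π := fun _ => X) n ω) * g (ω (n + 1)) ∂(pathLaw μ M) =
      ∫⁻ ω, f (Preorder.frestrictLe (π := fun _ => X) n ω) * ∫⁻ y, g y ∂(M (n + 1) (ω n))
        ∂(pathLaw μ M) := by
  have hfg : Measurable fun q : ((_ : Finset.Iic n) → X) × X => f q.1 * g q.2 := by fun_prop
  have : IsProbabilityMeasure ((Kernel.trajMeasure (X := fun _ => X) μ (step M)).map
      (Preorder.frestrictLe (π := fun _ => X) n)) :=
    Measure.isProbabilityMeasure_map (by fun_prop)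
  calc ∫⁻ ω, f (Preorder.frestrictLe (π := fun _ => X) n ω) * g (ω (n + 1)) ∂(pathLaw μ M)
      = ∫⁻ q, f q.1 * g q.2 ∂((pathLaw μ M).map
          (fun x => (Preorder.frestrictLe (π := fun _ => X) n x, x (n + 1)))) := by
        rw [lintegral_map hfg (by fun_prop)]
    _ = ∫⁻ z, ∫⁻ y, f z * g y ∂(step M n z)
          ∂((pathLaw μ M).map (Preorder.frestrictLe (π := fun _ => X) n)) := by
        rw [pathLaw, ← Kernel.map_frestrictLe_trajMeasure_compProd_eq_map_trajMeasure,
          Measure.lintegral_compProd hfg]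
    _ = ∫⁻ ω, ∫⁻ y, f (Preorder.frestrictLe (π := fun _ => X) n ω) * g y ∂(M (n + 1) (ω n))
          ∂(pathLaw μ M) := by
        rw [lintegral_map (Measurable.lintegral_kernel_prod_right' (κ := step M n) hfg)
          (by fun_prop)]
        rfl
    _ = _ := by simp only [lintegral_const_mul _ hg]

variable {G : ℕ → X → ℝ}

lemma lintegral_pathLaw_prod_mul (hG : ∀ n, Measurable (G n)) (n : ℕ) {f : X → ℝ≥0∞}
    (hf : Measurable f) :
    ∫⁻ ω, (∏ p ∈ Finset.range n, ENNReal.ofReal (G p (ω p))) * f (ω n) ∂(pathLaw μ M) =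
      ∫⁻ x, f x ∂(flow μ (potentialKernel M G) n) := by
  induction n generalizing f with
  | zero => simpa only [Finset.prod_range_zero, one_mul, flow] using lintegral_pathLaw_zero μ M hf
  | succ n ih =>
    have hmeas : Measurable fun z : (_ : Finset.Iic n) → X =>
        ∏ p ∈ (Finset.range (n + 1)).attach, ENNReal.ofReal
          (G p (z ⟨p, Finset.mem_Iic.2 (Finset.mem_range_succ_iff.1 p.2)⟩)) :=
      Finset.measurable_fun_prod _ fun p _ =>
        ((hG p).comp (measurable_pi_apply _)).ennreal_ofReal
    have hattach (ω : ℕ → X) : ∏ p ∈ (Finset.range (n + 1)).attach, ENNReal.ofReal (G p (ω p)) =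
        ∏ p ∈ Finset.range (n + 1), ENNReal.ofReal (G p (ω p)) :=
      Finset.prod_attach _ fun p => ENNReal.ofReal (G p (ω p))
    have hstep := lintegral_pathLaw_succ μ M n hmeas hf
    simp only [Preorder.frestrictLe_apply, hattach] at hstep
    rw [hstep, lintegral_flow_succ n hf, ← ih hf.lintegral_kernel]
    simp only [Finset.prod_range_succ, mul_assoc, lintegral_potentialKernel M (hG n)]

lemma weightedExpectation_prod (hG : ∀ n, Measurable (G n)) {φ : ℕ → X → ℝ}
    (hφ : ∀ n, Measurable (φ n)) (h0 : ∀ n x, 0 ≤ G n x * φ n x) (n : ℕ) :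
    weightedExpectation μ M G n (fun ω => ∏ p ∈ Finset.range (n + 1), φ p (ω p)) =
      ∫⁻ x, ENNReal.ofReal (φ n x) ∂(flow μ (potentialKernel M fun p x => G p x * φ p x) n) := by
  have hGφ (p : ℕ) : Measurable fun x => G p x * φ p x := (hG p).mul (hφ p)
  rw [← lintegral_pathLaw_prod_mul μ M hGφ n (hφ n).ennreal_ofReal, weightedExpectation]
  refine lintegral_congr fun ω => ?_
  rw [Finset.prod_range_succ, ← mul_assoc, ← Finset.prod_mul_distrib,
    ENNReal.ofReal_mul (Finset.prod_nonneg fun p _ => h0 p _),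
    ENNReal.ofReal_prod_of_nonneg fun p _ => h0 p _]

lemma weightedExpectation_one (hG : ∀ n, Measurable (G n)) (hG0 : ∀ n x, 0 ≤ G n x) (n : ℕ) :
    weightedExpectation μ M G n (fun _ => 1) = flow μ (potentialKernel M G) n univ := by
  simpa using weightedExpectation_prod μ M hG (φ := fun _ _ => 1) (fun _ => measurable_const)
    (by simpa using hG0) n

lemma weightedExpectation_exp_sum (hG : ∀ n, Measurable (G n)) (hG0 : ∀ n x, 0 ≤ G n x)
    {φ : ℕ → X → ℝ} (hφ : ∀ n, Measurable (φ n)) {n : ℕ} {I : Finset ℕ}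
    (hI : I ⊆ Finset.range (n + 1)) :
    weightedExpectation μ M G n (fun ω => Real.exp (∑ p ∈ I, φ p (ω p))) =
      ∫⁻ x, ENNReal.ofReal (if n ∈ I then Real.exp (φ n x) else 1) ∂(flow μ
        (potentialKernel M fun p x => G p x * if p ∈ I then Real.exp (φ p x) else 1) n) := by
  have hmeas (p : ℕ) : Measurable fun x => if p ∈ I then Real.exp (φ p x) else 1 := by
    split_ifs <;> fun_prop
  rw [← weightedExpectation_prod μ M hG hmeas fun p x => mul_nonneg (hG0 p x) (by positivity)]
  simp only [Real.exp_sum, Finset.prod_ite_mem, Finset.inter_eq_right.2 hI]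

end PathLaw

section WeightedExpectation

lemma ofReal_ite_exp_le {Y : Type*} {V φ : Y → ℝ} {δ : ℝ} {q : Prop} [Decidable q] {x : Y}
    (hV : 0 ≤ V x) (hδ : δ ≤ 1 ∨ ¬q) :
    ENNReal.ofReal (if q then Real.exp (φ x) else 1) ≤
      (if q then weightedNorm (fun x => Real.exp (V x) ^ δ) (fun x => Real.exp (φ x)) else 1) *
        expWeight V x := by
  split_ifs with hq
  · calc ENNReal.ofReal (Real.exp (φ x))
        ≤ weightedNorm (fun x => Real.exp (V x) ^ δ) (fun x => Real.exp (φ x)) *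
            ENNReal.ofReal (Real.exp (V x) ^ δ) :=
          ofReal_le_weightedNorm_mul (φ := fun x => Real.exp (φ x)) (by positivity)
      _ ≤ weightedNorm (fun x => Real.exp (V x) ^ δ) (fun x => Real.exp (φ x)) *
            expWeight V x := by
          gcongr
          exact ENNReal.ofReal_le_ofReal (Real.rpow_le_self_of_one_le (Real.one_le_exp hV)
            (hδ.resolve_right (not_not_intro hq)))
  · simpa only [ENNReal.ofReal_one, one_mul] using one_le_expWeight hV

variable {X : Type*} [MeasurableSpace X] {μ : Measure X} [IsProbabilityMeasure μ]
  {M : ℕ → Kernel X X} [∀ n, IsMarkovKernel (M n)] {G : ℕ → X → ℝ} {V : X → ℝ} {δ dmin : ℝ}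
  {B : ℝ≥0} {α : ℝ → ℝ → ℝ≥0} {κ : ℝ → ℝ≥0}

lemma LocallyControlled.lintegral_flow_insert_exp_le
    (h : LocallyControlled (potentialKernel M G) V δ dmin B α κ) (hG : ∀ n, Measurable (G n))
    (hG0 : ∀ n x, 0 ≤ G n x) {S T : ℝ≥0∞}
    (hS : ∀ k p x, semigroup (potentialKernel M G) (expWeight V) k p x *
      flow μ (potentialKernel M G) p univ ≤
        S * expWeight V x * flow μ (potentialKernel M G) (p + k) univ)
    (hT : ∀ n, flow μ (potentialKernel M G) n univ ≤
      T * flow μ (potentialKernel M G) (n + 1) univ)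
    (hfin : ∀ n, flow μ (potentialKernel M G) n univ ≠ ∞) {φ : ℕ → X → ℝ}
    (hφ : ∀ n, Measurable (φ n)) (I : Finset ℕ) (n : ℕ) :
    ∫⁻ x, expWeight V x ∂(flow μ
        (potentialKernel M fun p x => G p x * if p ∈ I then Real.exp (φ p x) else 1) n) ≤
      S * (∏ p ∈ Finset.range n, if p ∈ I then S * T * (B * weightedNorm
        (fun x => Real.exp (V x) ^ δ) (fun x => Real.exp (φ p x))) else 1) *
        (∫⁻ x, expWeight V x ∂μ) * flow μ (potentialKernel M G) n univ := by
  refine lintegral_semigroup_flow_perturbed_le (measurable_expWeight h.measurable) hS hT hfin I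
    (fun p hp => ?_) (fun p hp x => ?_) n 0
  · simp only [potentialKernel, hp, if_false, mul_one]
  · have hexp : (fun x => if p ∈ I then Real.exp (φ p x) else 1) = fun x => Real.exp (φ p x) :=
      funext fun x => if_pos hp
    simpa only [hexp] using h.lintegral_potentialKernel_mul_le
      (φ := fun p x => if p ∈ I then Real.exp (φ p x) else 1) (hG p) (hG0 p) (hexp ▸ (hφ p).exp) x

lemma LocallyControlled.weightedExpectation_exp_sum_le
    (h : LocallyControlled (potentialKernel M G) V δ dmin B α κ) (hG : ∀ n, Measurable (G n))
    (hG0 : ∀ n x, 0 ≤ G n x) {S T c : ℝ≥0∞}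
    (hS : ∀ k p x, semigroup (potentialKernel M G) (expWeight V) k p x *
      flow μ (potentialKernel M G) p univ ≤
        S * expWeight V x * flow μ (potentialKernel M G) (p + k) univ)
    (hT : ∀ n, flow μ (potentialKernel M G) n univ ≤
      T * flow μ (potentialKernel M G) (n + 1) univ)
    (hfin : ∀ n, flow μ (potentialKernel M G) n univ ≠ ∞) (hc1 : 1 ≤ c) (hc : S * T * B ≤ c)
    {φ : ℕ → X → ℝ} (hφ : ∀ n, Measurable (φ n)) {n : ℕ} {I : Finset ℕ}
    (hI : I ⊆ Finset.range (n + 1)) (hn : δ ≤ 1 ∨ n ∉ I) :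
    weightedExpectation μ M G n (fun ω => Real.exp (∑ p ∈ I, φ p (ω p))) ≤
      S * (c ^ I.card *
        ∏ p ∈ I, weightedNorm (fun x => Real.exp (V x) ^ δ) (fun x => Real.exp (φ p x))) *
        (∫⁻ x, expWeight V x ∂μ) * flow μ (potentialKernel M G) n univ := by
  set N : ℕ → ℝ≥0∞ := fun p =>
    weightedNorm (fun x => Real.exp (V x) ^ δ) (fun x => Real.exp (φ p x))
  set e : ℕ → ℝ≥0∞ := fun p => if p ∈ I then c * N p else 1
  set η := flow μ (potentialKernel M fun p x => G p x * if p ∈ I then Real.exp (φ p x) else 1) n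
  have hlast : (if n ∈ I then N n else 1) ≤ e n := by
    simp only [e]
    split_ifs
    exacts [le_mul_of_one_le_left' hc1, le_rfl]
  have hbefore : ∏ p ∈ Finset.range n, (if p ∈ I then S * T * (B * N p) else 1) ≤
      ∏ p ∈ Finset.range n, e p := by
    refine Finset.prod_le_prod' fun p _ => ?_
    simp only [e]
    split_ifs
    exacts [(mul_assoc _ _ _).symm.trans_le (mul_le_mul_left hc _), le_rfl]
  calc weightedExpectation μ M G n (fun ω => Real.exp (∑ p ∈ I, φ p (ω p)))
      ≤ ∫⁻ x, (if n ∈ I then N n else 1) * expWeight V x ∂η :=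
        (weightedExpectation_exp_sum μ M hG hG0 hφ hI).trans_le
          (lintegral_mono fun x => ofReal_ite_exp_le (h.nonneg x) hn)
    _ = (if n ∈ I then N n else 1) * ∫⁻ x, expWeight V x ∂η :=
        lintegral_const_mul _ (measurable_expWeight h.measurable)
    _ ≤ e n * (S * (∏ p ∈ Finset.range n, e p) * (∫⁻ x, expWeight V x ∂μ) *
          flow μ (potentialKernel M G) n univ) :=
        mul_le_mul' hlast ((h.lintegral_flow_insert_exp_le hG hG0 hS hT hfin hφ I n).trans
          (by gcongr))
    _ = S * (∏ p ∈ Finset.range (n + 1), e p) * (∫⁻ x, expWeight V x ∂μ) *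
          flow μ (potentialKernel M G) n univ := by rw [Finset.prod_range_succ]; ring
    _ = _ := by
        rw [Finset.prod_ite_mem, Finset.inter_eq_right.2 hI, Finset.prod_mul_distrib,
          Finset.prod_const]

end WeightedExpectation

end FeynmanKac

open FeynmanKac in
theorem theorem4_general {X : Type*} [MeasurableSpace X] (μ : Measure X) [IsProbabilityMeasure μ]
    (V : X → ℝ) (hμ : ∫⁻ x, expWeight V x ∂μ ≠ ∞) {δ : ℝ} (hδ : 0 < δ)
    (dmin : ℝ) (B : ℝ≥0) (α : ℝ → ℝ → ℝ≥0) (κ : ℝ → ℝ≥0) :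
    ∃ c : ℝ≥0, ∀ (M : ℕ → Kernel X X) [∀ n, IsMarkovKernel (M n)] (G : ℕ → X → ℝ),
      (∀ n, Measurable (G n)) → (∀ n x, 0 ≤ G n x) →
      LocallyControlled (potentialKernel M G) V δ dmin B α κ →
      ∀ F : ℕ → X → ℝ, (∀ k, Measurable (F k)) →
      ∀ n, ∀ I ⊆ Finset.range (n + 1), (δ ≤ 1 ∨ n ∉ I) →
        weightedExpectation μ M G n (fun _ => 1) ≠ 0 ∧
        weightedExpectation μ M G n (fun _ => 1) ≠ ∞ ∧
        weightedExpectation μ M G n (fun ω => Real.exp (∑ k ∈ I, |F k (ω k)|)) /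
            weightedExpectation μ M G n (fun _ => 1) ≤
          (c : ℝ≥0∞) ^ I.card * (∫⁻ x, expWeight V x ∂μ) *
            ∏ k ∈ I, weightedNorm (fun x => Real.exp (V x) ^ δ) (fun x => Real.exp |F k x|) := by
  have hμ0 : μ ≠ 0 := IsProbabilityMeasure.ne_zero μ
  obtain ⟨S, T, hST⟩ :=
    LocallyControlled.exists_flow_univ_le_and_semigroup_mul_flow_univ_le hμ0 hμ hδ dmin B α κ
  set c₀ : ℝ≥0 := max 1 (S * T * B)
  refine ⟨max 1 S * c₀, fun M _ G hG hG0 h F hF n I hI hn => ?_⟩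
  obtain ⟨hT, hS⟩ := hST _ h
  have hfin := h.flow_univ_ne_top hδ.le hμ
  rw [weightedExpectation_one μ M hG hG0]
  refine ⟨flow_univ_ne_zero hμ0 hT n, hfin n, ENNReal.div_le_of_le_mul ?_⟩
  set N := ∏ k ∈ I, weightedNorm (fun x => Real.exp (V x) ^ δ) (fun x => Real.exp |F k x|)
  set Z := flow μ (potentialKernel M G) n univ
  rcases I.eq_empty_or_nonempty with rfl | hIne
  · have hone : 1 ≤ ∫⁻ x, expWeight V x ∂μ :=
      measure_univ.symm.trans_le
        (measure_le_lintegral (fun x => one_le_expWeight (h.nonneg x)) μ univ)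
    simpa [weightedExpectation_one μ M hG hG0, N, Z] using le_mul_of_one_le_left' hone
  · calc weightedExpectation μ M G n (fun ω => Real.exp (∑ k ∈ I, |F k (ω k)|))
        ≤ S * (c₀ ^ I.card * N) * (∫⁻ x, expWeight V x ∂μ) * Z :=
          h.weightedExpectation_exp_sum_le hG hG0 hS hT hfin (by simp [c₀])
            (by simp [c₀]) (fun k => (hF k).abs) hI hn
      _ ≤ max 1 S ^ I.card * (c₀ ^ I.card * N) * (∫⁻ x, expWeight V x ∂μ) * Z := by
          gcongr
          exact_mod_cast (le_max_right 1 S).trans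
            (le_self_pow₀ (le_max_left 1 S) hIne.card_ne_zero)
      _ = ((max 1 S * c₀ : ℝ≥0) : ℝ≥0∞) ^ I.card * (∫⁻ x, expWeight V x ∂μ) * N * Z := by
          rw [ENNReal.coe_mul, mul_pow]
          ring

theorem theorem4 {X : Type*} [TopologicalSpace X] [PolishSpace X] [NoncompactSpace X]
    [MeasurableSpace X] [BorelSpace X]
    (μ : Measure X) (V : X → ℝ) (δ dmin : ℝ) (b εminus εplus : ℝ → ℝ) (ν : ℝ → Measure X)
    (H2 : FeynmanKac.MemPv (fun x => Real.exp (V x)) μ) :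
    ∃ c : ℝ≥0, ∀ (M : ℕ → Kernel X X) [∀ n, IsMarkovKernel (M n)] (G : ℕ → X → ℝ),
      (∀ n, Measurable (G n)) → (∀ n x, 0 < G n x) →
      FeynmanKac.DriftCondition M G V δ dmin b →
      FeynmanKac.MinorizationCondition M G V dmin εminus ν →
      FeynmanKac.MajorizationCondition M G V dmin εminus εplus ν →
      ∀ F : ℕ → X → ℝ, (∀ k, Measurable (F k)) →
        (∀ k, BddAbove (Set.range fun x => |F k x| - δ * V x)) →
      ∀ n s : ℕ, 1 ≤ n → s ≤ n + 1 → ∀ i ∈ FeynmanKac.indexTuples n s,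
        (δ ≤ 1 ∨ ∀ j, i j < n) →
        FeynmanKac.weightedExpectation μ M G n (fun _ => 1) ≠ 0 ∧
        FeynmanKac.weightedExpectation μ M G n (fun _ => 1) ≠ ∞ ∧
        FeynmanKac.weightedExpectation μ M G n
              (fun ω => Real.exp (∑ j, |F (i j) (ω (i j))|)) /
            FeynmanKac.weightedExpectation μ M G n (fun _ => 1) ≤
          (c : ℝ≥0∞) ^ s * (∫⁻ x, ENNReal.ofReal (Real.exp (V x)) ∂μ) *
            ∏ j, FeynmanKac.weightedNorm (fun x => Real.exp (V x) ^ δ)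
              (fun x => Real.exp |F (i j) x|) := by
  by_cases hδ : 0 < δ
  · have := H2.1
    obtain ⟨c, hc⟩ := theorem4_general μ V H2.2.ne hδ dmin _ _ _
    refine ⟨c, fun M _ G hG hG0 h1 h3 h4 F hF _ n s _ _ i hi hin => ?_⟩
    simpa [FeynmanKac.expWeight] using hc M G hG (fun n x => (hG0 n x).le)
      (FeynmanKac.locallyControlled_potentialKernel hG h1 h3 h4) F hF n
      (Finset.univ.map ⟨i, hi.1.injective⟩)
      (by simpa [Finset.subset_iff, Nat.lt_succ_iff] using hi.2)
      (by simpa using hin.imp_right fun h j => (h j).ne)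
  · exact ⟨0, fun _ _ _ _ _ h1 => (hδ h1.delta_pos).elim⟩
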